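/- Let $c_0,c_1\in\mathbb R^n$, $b_0,b_1\in\mathbb R^m$, $A_0,A_1\in\mathbb R^{m\times n}$, and for real $\varepsilon$ consider the linear program $$\max\ \langle c_0+\varepsilon c_1,x\rangle\quad\text{s.t.}\quad (A_0+\varepsilon A_1)x=b_0+\varepsilon b_1,\ x\ge 0,$$ with feasible set $\theta(\varepsilon)$, set of optimal solutions $\theta^*(\varepsilon)$ and optimal value $F^*(\varepsilon)=\sup_{x\in\theta(\varepsilon)}\langle c_0+\varepsilon c_1,x\rangle\in[-\infty,\infty]$ (with $\sup\emptyset=-\infty$). Let $J_0=\{j:\ x_j>0\text{ for some }x\in\theta(0)\}$, $$\Theta_1=\{(x^0,x^1)\in\mathbb R^n\times\mathbb R^n:\ x^0\in\theta(0),\ A_0x^1+A_1x^0=b_1,\ x^1_j\ge 0\ \ \forall j\notin J_0\},\qquad \theta_1=\{x^0:\ \exists x^1,\ (x^0,x^1)\in\Theta_1\}.$$ The limiting linear program is $\max\{\langle c_0,x\rangle:\ x\in\theta_1\}$; let $F_1^*=\sup_{x\in\theta_1}\langle c_0,x\rangle\in[-\infty,\infty]$ be its value and $\theta_1^*$ its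 set of optimal solutions. For a family of sets $S(\varepsilon)\subset\mathbb R^n$, $\limsup_{\varepsilon\downarrow0}S(\varepsilon)$ (resp. $\liminf_{\varepsilon\downarrow0}S(\varepsilon)$) is the set of $x$ such that every neighbourhood of $x$ meets $S(\varepsilon)$ for arbitrarily small $\varepsilon>0$ (resp. for all sufficiently small $\varepsilon>0$). A vector $x$ is called feasible limiting optimal if $x\in\liminf_{\varepsilon\downarrow 0}\theta(\varepsilon)$ and $\lim_{\varepsilon\downarrow 0}F^*(\varepsilon)=\langle c_0,x\rangle$. Assume that for all sufficiently small $\varepsilon>0$ the program is not unbounded, i.e. $F^*(\varepsilon)<+\infty$, and that * $(H_0^*)$ there are $\gamma_0>0$ and a bounded set $B\subset\mathbb R^n$ with $\theta^*(\varepsilon)\subset B$ for every $\varepsilon\in(0,\gamma_0]$; * $(H_2)$ $\operatorname{rank}(A_0+\varepsilon A_1)=m$ for all sufficiently small $\varepsilon>0$. Then $$\limsup_{\varepsilon\downarrow 0}\theta^*(\varepsilon)\subset\theta_1\qquad\text{and}\qquad \limsup_{\varepsilon\downarrow 0}F^*(\varepsilon)\le F_1^*.$$ If in addition $(H_1)$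 $\operatorname{rank}A_0=m$, and the extended Slater condition of order 1 (ES-1) holds, i.e. there is $(\hat x^0,\hat x^1)\in\Theta_1$ with $\hat x^1_j>0$ for all $j\notin J_0$ and $\hat x^0_j>0$ for all $j\in J_0$, then $$\limsup_{\varepsilon\downarrow 0}\theta^*(\varepsilon)\subset\theta_1^*,\qquad \lim_{\varepsilon\downarrow 0}F^*(\varepsilon)=F_1^*,$$ and every optimal solution of the limiting linear program is feasible limiting optimal. -/

import Mathlib

open Filter Topology

/-- Painlevé–Kuratowski outer limit of `S ε` as `ε ↓ 0`: the set of cluster points, i.e. of all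
`x = lim x_k` with `x_k ∈ S (ε_k)` for some sequence `ε_k ↓ 0`. -/
def outerLimit {E : Type*} [TopologicalSpace E] (S : ℝ → Set E) : Set E :=
  {x | ∀ U ∈ 𝓝 x, ∃ᶠ ε in 𝓝[>] (0 : ℝ), (S ε ∩ U).Nonempty}

/-- Painlevé–Kuratowski inner limit of `S ε` as `ε ↓ 0`: every neighbourhood of `x` meets `S ε`
for all sufficiently small `ε > 0`. -/
def innerLimit {E : Type*} [TopologicalSpace E] (S : ℝ → Set E) : Set E :=
  {x | ∀ U ∈ 𝓝 x, ∀ᶠ ε in 𝓝[>] (0 : ℝ), (S ε ∩ U).Nonempty}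

/-- The data of the family of linear programs
`max ⟨c₀ + ε c₁, x⟩` subject to `(A₀ + ε A₁) x = b₀ + ε b₁`, `x ≥ 0`. -/
structure PerturbedLP (m n : ℕ) where
  c₀ : Fin n → ℝ
  c₁ : Fin n → ℝ
  b₀ : Fin m → ℝ
  b₁ : Fin m → ℝ
  A₀ : Matrix (Fin m) (Fin n) ℝ
  A₁ : Matrix (Fin m) (Fin n) ℝ

namespace PerturbedLP

variable {m n : ℕ} (P : PerturbedLP m n)

/-- The feasible set `θ(ε)`. -/
def feasible (ε : ℝ) : Set (Fin n → ℝ) :=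
  {x | (P.A₀ + ε • P.A₁).mulVec x = P.b₀ + ε • P.b₁ ∧ ∀ j, 0 ≤ x j}

/-- The objective `⟨c₀ + ε c₁, x⟩`. -/
def objective (ε : ℝ) (x : Fin n → ℝ) : ℝ :=
  (P.c₀ + ε • P.c₁) ⬝ᵥ x

/-- The set `θ*(ε)` of optimal solutions. -/
def optimal (ε : ℝ) : Set (Fin n → ℝ) :=
  {x | x ∈ P.feasible ε ∧ ∀ y ∈ P.feasible ε, P.objective ε y ≤ P.objective ε x}

/-- The optimal value `F*(ε)`, with value `⊥` for an infeasible and `⊤` for an unbounded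
program. -/
noncomputable def value (ε : ℝ) : EReal :=
  ⨆ x ∈ P.feasible ε, (P.objective ε x : EReal)

/-- The index set `J₀`. -/
def J₀ : Set (Fin n) :=
  {j | ∃ x ∈ P.feasible 0, 0 < x j}

/-- The set `Θ₁` of pairs `(x⁰, x¹)`. -/
def bigTheta₁ : Set ((Fin n → ℝ) × (Fin n → ℝ)) :=
  {p | p.1 ∈ P.feasible 0 ∧ P.A₀.mulVec p.2 + P.A₁.mulVec p.1 = P.b₁ ∧
    ∀ j, j ∉ P.J₀ → 0 ≤ p.2 j}

/-- The feasible set `θ₁` of the limiting program. -/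
def theta₁ : Set (Fin n → ℝ) :=
  {x0 | ∃ x1, (x0, x1) ∈ P.bigTheta₁}

/-- The optimal value `F₁*` of the limiting program `max {⟨c₀, x⟩ : x ∈ θ₁}`. -/
noncomputable def value₁ : EReal :=
  ⨆ x ∈ P.theta₁, ((P.c₀ ⬝ᵥ x : ℝ) : EReal)

/-- The set `θ₁*` of optimal solutions of the limiting program. -/
def optimal₁ : Set (Fin n → ℝ) :=
  {x | x ∈ P.theta₁ ∧ ∀ y ∈ P.theta₁, P.c₀ ⬝ᵥ y ≤ P.c₀ ⬝ᵥ x}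

/-- Assumption (H₀*): the optimal sets are uniformly bounded for small `ε > 0`. -/
def H₀star : Prop :=
  ∃ γ₀ : ℝ, 0 < γ₀ ∧ ∃ B : Set (Fin n → ℝ), Bornology.IsBounded B ∧
    ∀ ε ∈ Set.Ioc 0 γ₀, P.optimal ε ⊆ B

/-- Assumption (H₁): `A₀` has rank `m`. -/
def H₁ : Prop := P.A₀.rank = m

/-- Assumption (H₂): `A₀ + ε A₁` has rank `m` for all sufficiently small `ε > 0`. -/
def H₂ : Prop := ∀ᶠ ε in 𝓝[>] (0 : ℝ), (P.A₀ + ε • P.A₁).rank = m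

/-- The extended Slater condition of order 1. -/
def ES1 : Prop :=
  ∃ x0 x1 : Fin n → ℝ, (x0, x1) ∈ P.bigTheta₁ ∧
    (∀ j, j ∉ P.J₀ → 0 < x1 j) ∧ (∀ j, j ∈ P.J₀ → 0 < x0 j)

/-- `x` is feasible limiting optimal for the perturbed program. -/
def FeasibleLimitingOptimal (x : Fin n → ℝ) : Prop :=
  x ∈ innerLimit P.feasible ∧
    Tendsto P.value (𝓝[>] (0 : ℝ)) (𝓝 ((P.c₀ ⬝ᵥ x : ℝ) : EReal))

end PerturbedLP

/-! If feasible points `x(ε)` tend to `x`, then `A₀ ((x(ε) - x)/ε) = b₁ - A₁ x(ε)`, and the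
quotients are nonnegative off `J₀`. They may be unbounded, but a linear image of a polyhedral cone
is closed, so the limit `b₁ - A₁ x` is still of the form `A₀ x¹` with `x¹` nonnegative off `J₀`.
This is `mem_theta₁_of_tendsto`; combined with attainment of finite optima and compactness it bounds
the limsup of the values.

Conversely, when `A₀` is onto, a strictly admissible pair gives `x⁰ + ε x¹` up to an `O(ε²)`
correction that restores feasibility (`exists_feasible_tendsto`). Mixing in a little of the Slater
pair makes any pair in `Θ₁` strict, so `θ₁` lies in the inner limit of the feasible sets; the
remaining claims follow by comparing objectives. -/

/-! ### Closedness of finitely generated cones -/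

section Cone

variable {ι E : Type*} [Fintype ι] [NormedAddCommGroup E] [NormedSpace ℝ E]

/-- If a linear map kills a nonzero vector supported in `s`, then the image of a nonnegative vector
supported in `s` is also the image of one supported in a smaller set. -/
theorem exists_nonneg_map_eq_of_ker [DecidableEq ι] (L : (ι → ℝ) →ₗ[ℝ] E) {s : Finset ι}
    {g w : ι → ℝ} (hgs : ∀ i ∉ s, g i = 0) (hLg : L g = 0) (hpos : ∃ i, 0 < g i)
    (hw : 0 ≤ w) (hws : ∀ i ∉ s, w i = 0) :
    ∃ i ∈ s, ∃ w' : ι → ℝ, 0 ≤ w' ∧ (∀ k ∉ s.erase i, w' k = 0) ∧ L w' = L w := by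
  -- Ratio test: `w i / g i` is the largest multiple of `g` that can be subtracted from `w` without
  -- leaving the orthant, and it annihilates coordinate `i`.
  obtain ⟨i, hi, hmin⟩ := Finset.exists_min_image (Finset.univ.filter fun i => 0 < g i)
    (fun i => w i / g i) (by obtain ⟨i, hi⟩ := hpos; exact ⟨i, by simpa using hi⟩)
  have hgi : 0 < g i := by simpa using hi
  have his : i ∈ s := by
    by_contra h
    exact hgi.ne' (hgs i h)
  refine ⟨i, his, w - (w i / g i) • g, fun k => ?_, fun k hk => ?_, by simp [hLg]⟩
  · have hr : 0 ≤ w i / g i := div_nonneg (hw i) hgi.le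
    simp only [Pi.zero_apply, Pi.sub_apply, Pi.smul_apply, smul_eq_mul, sub_nonneg]
    rcases lt_or_ge 0 (g k) with hk | hk
    · exact (le_div_iff₀ hk).1 (hmin k (by simpa using hk))
    · exact (mul_nonpos_of_nonneg_of_nonpos hr hk).trans (hw k)
  · by_cases hki : k = i
    · subst hki
      simp [div_mul_cancel₀ _ hgi.ne']
    · have hks : k ∉ s := fun h => hk (Finset.mem_erase.2 ⟨hki, h⟩)
      simp [hgs k hks, hws k hks]

/-- A face of the nonnegative orthant has closed image under any linear map. -/
theorem isClosed_image_nonneg_face (L : (ι → ℝ) →ₗ[ℝ] E) (s : Finset ι) :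
    IsClosed (L '' {w | 0 ≤ w ∧ ∀ i ∉ s, w i = 0}) := by
  classical
  -- Either `L` is injective on the coordinate subspace, hence a closed embedding there, or a kernel
  -- vector reduces the image to a finite union of images of smaller faces.
  induction s using Finset.strongInduction with
  | H s ih =>
    let W : Submodule ℝ (ι → ℝ) :=
      { carrier := {w | ∀ i ∉ s, w i = 0}
        zero_mem' := fun i _ => rfl
        add_mem' := fun ha hb i hi => by simp [ha i hi, hb i hi]
        smul_mem' := fun c a ha i hi => by simp [ha i hi] }
    by_cases hinj : LinearMap.ker (L ∘ₗ W.subtype) = ⊥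
    · have hemb : IsClosedEmbedding (L ∘ₗ W.subtype) :=
        LinearMap.isClosedEmbedding_of_injective hinj
      have hcl : IsClosed {w : W | 0 ≤ (w : ι → ℝ)} :=
        isClosed_le continuous_const continuous_subtype_val
      convert hemb.isClosedMap _ hcl using 1
      ext x
      constructor
      · rintro ⟨w, ⟨hw, hws⟩, rfl⟩
        exact ⟨⟨w, hws⟩, hw, rfl⟩
      · rintro ⟨w, hw, rfl⟩
        exact ⟨w, ⟨hw, w.2⟩, rfl⟩
    · obtain ⟨⟨g, hgs⟩, hg, hg0⟩ := (Submodule.ne_bot_iff _).1 hinj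
      have hLg : L g = 0 := hg
      have hg0 : g ≠ 0 := fun h => hg0 (Subtype.ext h)
      obtain ⟨g, hgs, hLg, hpos⟩ :
          ∃ g : ι → ℝ, (∀ i ∉ s, g i = 0) ∧ L g = 0 ∧ ∃ i, 0 < g i := by
        obtain ⟨i, hi⟩ := Function.ne_iff.1 hg0
        rcases lt_or_gt_of_ne hi with h | h
        · exact ⟨-g, fun k hk => by simp [hgs k hk], by simp [hLg], i, by simpa using h⟩
        · exact ⟨g, hgs, hLg, i, h⟩
      have hU : L '' {w | 0 ≤ w ∧ ∀ i ∉ s, w i = 0} =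
          ⋃ i ∈ s, L '' {w | 0 ≤ w ∧ ∀ k ∉ s.erase i, w k = 0} := by
        ext x
        simp only [Set.mem_iUnion]
        constructor
        · rintro ⟨w, ⟨hw, hws⟩, rfl⟩
          obtain ⟨i, hi, w', hw', hws', hL⟩ :=
            exists_nonneg_map_eq_of_ker L hgs hLg hpos hw hws
          exact ⟨i, hi, w', ⟨hw', hws'⟩, hL⟩
        · rintro ⟨i, -, w, ⟨hw, hws⟩, rfl⟩
          exact ⟨w, ⟨hw, fun k hk => hws k fun h => hk (Finset.mem_of_mem_erase h)⟩, rfl⟩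
      rw [hU]
      exact s.finite_toSet.isClosed_biUnion fun i hi => ih _ (Finset.erase_ssubset hi)

/-- The image of the nonnegative orthant under a linear map, that is, a finitely generated cone,
is closed. -/
theorem isClosed_image_nonneg (L : (ι → ℝ) →ₗ[ℝ] E) : IsClosed (L '' {w | 0 ≤ w}) := by
  simpa using isClosed_image_nonneg_face L Finset.univ

/-- A linear image of a product of half-lines and lines is closed. -/
theorem isClosed_image_nonneg_off (L : (ι → ℝ) →ₗ[ℝ] E) (J : Set ι) :
    IsClosed (L '' {w | ∀ i ∉ J, 0 ≤ w i}) := by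
  classical
  -- A free coordinate is a difference of two nonnegative ones.
  let K : (ι ⊕ ι → ℝ) →ₗ[ℝ] (ι → ℝ) :=
    { toFun := fun w i => w (.inl i) - if i ∈ J then w (.inr i) else 0
      map_add' := fun v w => by
        ext i
        by_cases h : i ∈ J <;> simp [h]
        ring
      map_smul' := fun c w => by
        ext i
        by_cases h : i ∈ J <;> simp [h, mul_sub] }
  have hK : K '' {w | 0 ≤ w} = {w | ∀ i ∉ J, 0 ≤ w i} := by
    ext y
    constructor
    · rintro ⟨w, hw, rfl⟩ i hi
      simpa [K, hi] using hw (.inl i)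
    · intro hy
      refine ⟨Sum.elim (fun i => max (y i) 0) (fun i => max (-y i) 0), ?_, ?_⟩
      · rintro (i | i) <;> simp
      · ext i
        by_cases h : i ∈ J
        · rcases le_total 0 (y i) with h' | h' <;> simp [K, h, h']
        · simpa [K, h] using hy i h
  have := isClosed_image_nonneg (L ∘ₗ K)
  rwa [LinearMap.coe_comp, Set.image_comp, hK] at this

end Cone

/-! ### Outer limits along filters -/

/-- A point of the outer limit is a limit, along some nontrivial filter, of points of the sets. -/
theorem exists_tendsto_of_mem_outerLimit {E : Type*} [TopologicalSpace E] {S : ℝ → Set E} {x : E}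
    (hx : x ∈ outerLimit S) :
    ∃ l : Filter (ℝ × E), l.NeBot ∧ Tendsto Prod.fst l (𝓝[>] 0) ∧ Tendsto Prod.snd l (𝓝 x) ∧
      ∀ᶠ p in l, p.2 ∈ S p.1 := by
  refine ⟨(𝓝[>] 0 ×ˢ 𝓝 x) ⊓ 𝓟 {p | p.2 ∈ S p.1}, ?_, tendsto_fst.mono_left inf_le_left,
    tendsto_snd.mono_left inf_le_left, mem_inf_of_right (mem_principal_self _)⟩
  rw [← frequently_mem_iff_neBot, Filter.frequently_iff]
  intro T hT
  obtain ⟨V, hV, U, hU, hVU⟩ := mem_prod_iff.1 hT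
  obtain ⟨ε, ⟨y, hyS, hyU⟩, hε⟩ := ((hx U hU).and_eventually hV).exists
  exact ⟨(ε, y), hVU ⟨hε, hyU⟩, hyS⟩

namespace PerturbedLP

variable {m n : ℕ} (P : PerturbedLP m n)

/-! ### Existence of optimal solutions -/

/-- A feasible linear program whose value is finite has an optimal solution. -/
theorem optimal_nonempty {ε : ℝ} (hf : (P.feasible ε).Nonempty) (hv : P.value ε < ⊤) :
    (P.optimal ε).Nonempty := by
  let L : (Fin n → ℝ) →ₗ[ℝ] (Fin m → ℝ) × ℝ :=
    (P.A₀ + ε • P.A₁).mulVecLin.prod (dotProductBilin ℝ ℝ (P.c₀ + ε • P.c₁))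
  -- The attained objective values form a slice of a closed cone, so their supremum is attained
  -- without any compactness.
  let T : Set ℝ := {t | (P.b₀ + ε • P.b₁, t) ∈ L '' {w | 0 ≤ w}}
  have hT : IsClosed T := (isClosed_image_nonneg L).preimage (by fun_prop)
  have hmem : ∀ x ∈ P.feasible ε, P.objective ε x ∈ T := fun x hx =>
    ⟨x, hx.2, Prod.ext hx.1 rfl⟩
  have hmem' : ∀ t ∈ T, ∃ x ∈ P.feasible ε, P.objective ε x = t := by
    rintro t ⟨x, hx, hLx⟩
    exact ⟨x, ⟨congrArg Prod.fst hLx, hx⟩, congrArg Prod.snd hLx⟩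
  have hbd : BddAbove T := by
    obtain ⟨r, hr, -⟩ := EReal.lt_iff_exists_real_btwn.1 hv
    refine ⟨r, fun t ht => ?_⟩
    obtain ⟨x, hx, rfl⟩ := hmem' t ht
    have : (P.objective ε x : EReal) ≤ P.value ε := le_iSup₂_of_le x hx le_rfl
    exact_mod_cast this.trans hr.le
  have hne : T.Nonempty := hf.elim fun x hx => ⟨_, hmem x hx⟩
  obtain ⟨x, hx, hxT⟩ := hmem' _ (hT.csSup_mem hne hbd)
  exact ⟨x, hx, fun y hy => hxT ▸ le_csSup hbd (hmem y hy)⟩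

theorem value_eq_of_mem_optimal {ε : ℝ} {x : Fin n → ℝ} (hx : x ∈ P.optimal ε) :
    P.value ε = P.objective ε x :=
  le_antisymm (iSup₂_le fun y hy => EReal.coe_le_coe_iff.2 (hx.2 y hy))
    (le_iSup₂_of_le x hx.1 le_rfl)

theorem value₁_eq_of_mem_optimal₁ {x : Fin n → ℝ} (hx : x ∈ P.optimal₁) :
    P.value₁ = ((P.c₀ ⬝ᵥ x : ℝ) : EReal) :=
  le_antisymm (iSup₂_le fun y hy => EReal.coe_le_coe_iff.2 (hx.2 y hy))
    (le_iSup₂_of_le x hx.1 le_rfl)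

/-! ### Limits of feasible points -/

theorem tendsto_objective {α : Type*} {l : Filter α} {e : α → ℝ} {y : α → Fin n → ℝ}
    {x : Fin n → ℝ} (he : Tendsto e l (𝓝 0)) (hy : Tendsto y l (𝓝 x)) :
    Tendsto (fun a => P.objective (e a) (y a)) l (𝓝 (P.c₀ ⬝ᵥ x)) := by
  have hc : Continuous fun p : ℝ × (Fin n → ℝ) => P.objective p.1 p.2 := by
    unfold objective
    exact Continuous.dotProduct (by fun_prop) (by fun_prop)
  have h0 : P.objective 0 x = P.c₀ ⬝ᵥ x := by simp [objective]
  simpa only [Function.comp_def, h0] using (hc.tendsto (0, x)).comp (he.prodMk_nhds hy)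

/-- Limits of feasible points, as the parameter decreases to `0`, are feasible for the limiting
program. -/
theorem mem_theta₁_of_tendsto {α : Type*} {l : Filter α} [l.NeBot] {e : α → ℝ}
    {y : α → Fin n → ℝ} {x : Fin n → ℝ} (he : Tendsto e l (𝓝[>] 0)) (hy : Tendsto y l (𝓝 x))
    (hf : ∀ᶠ a in l, y a ∈ P.feasible (e a)) : x ∈ P.theta₁ := by
  have he0 : Tendsto e l (𝓝 0) := he.mono_right nhdsWithin_le_nhds
  have hpos : ∀ᶠ a in l, 0 < e a := he.eventually self_mem_nhdsWithin
  have hA₀ : Tendsto (fun a => P.A₀.mulVec (y a)) l (𝓝 (P.A₀.mulVec x)) :=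
    ((Continuous.matrix_mulVec continuous_const continuous_id).tendsto x).comp hy
  have hA₁ : Tendsto (fun a => P.A₁.mulVec (y a)) l (𝓝 (P.A₁.mulVec x)) :=
    ((Continuous.matrix_mulVec continuous_const continuous_id).tendsto x).comp hy
  have hx0 : ∀ j, 0 ≤ x j := fun j =>
    ge_of_tendsto ((tendsto_pi_nhds.1 hy) j) (hf.mono fun a ha => ha.2 j)
  have hAx : P.A₀.mulVec x = P.b₀ := by
    have h1 : Tendsto (fun a => P.A₀.mulVec (y a) + e a • P.A₁.mulVec (y a)) l
        (𝓝 (P.A₀.mulVec x + (0 : ℝ) • P.A₁.mulVec x)) := hA₀.add (he0.smul hA₁)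
    have h2 : Tendsto (fun a => P.b₀ + e a • P.b₁) l (𝓝 (P.b₀ + (0 : ℝ) • P.b₁)) :=
      tendsto_const_nhds.add (he0.smul tendsto_const_nhds)
    have h3 := tendsto_nhds_unique (h1.congr' (hf.mono fun a ha => ?_)) h2
    · simpa using h3
    · rw [← ha.1, Matrix.add_mulVec, Matrix.smul_mulVec]
  have hx : x ∈ P.feasible 0 := ⟨by simpa using hAx, hx0⟩
  have hcl := isClosed_image_nonneg_off P.A₀.mulVecLin P.J₀
  obtain ⟨x1, hx1, hx1'⟩ := hcl.mem_of_tendsto (tendsto_const_nhds.sub hA₁ :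
    Tendsto (fun a => P.b₁ - P.A₁.mulVec (y a)) l _) (by
      filter_upwards [hf, hpos] with a ha hea
      refine ⟨(e a)⁻¹ • (y a - x), fun j hj => ?_, ?_⟩
      -- The limit `x` itself is feasible at `0`, so a positive `x j` would put `j` in `J₀`.
      · have hxj : x j ≤ 0 := not_lt.1 fun h => hj ⟨x, hx, h⟩
        have := ha.2 j
        simp only [Pi.smul_apply, Pi.sub_apply, smul_eq_mul]
        exact mul_nonneg (inv_nonneg.2 hea.le) (by linarith)
      · have h1 := ha.1
        rw [Matrix.add_mulVec, Matrix.smul_mulVec] at h1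
        have h2 : P.A₀.mulVec (y a) - P.b₀ = e a • (P.b₁ - P.A₁.mulVec (y a)) := by
          rw [smul_sub, sub_eq_sub_iff_add_eq_add, h1, add_comm]
        rw [Matrix.mulVecLin_apply, Matrix.mulVec_smul, Matrix.mulVec_sub, hAx, h2,
          inv_smul_smul₀ hea.ne'])
  refine ⟨x1, hx, ?_, hx1⟩
  rw [Matrix.mulVecLin_apply] at hx1'
  simp [hx1']

theorem outerLimit_optimal_subset_theta₁ : outerLimit P.optimal ⊆ P.theta₁ := by
  intro x hx
  obtain ⟨l, hl, h1, h2, h3⟩ := exists_tendsto_of_mem_outerLimit hx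
  exact P.mem_theta₁_of_tendsto h1 h2 (h3.mono fun p hp => hp.1)

theorem limsup_value_le_value₁ (hbdd : ∀ᶠ ε in 𝓝[>] (0 : ℝ), P.value ε < ⊤) (hH₀ : P.H₀star) :
    limsup P.value (𝓝[>] (0 : ℝ)) ≤ P.value₁ := by
  refine le_of_forall_lt fun a ha => ?_
  obtain ⟨a', haa', ha'⟩ := exists_between ha
  refine haa'.trans_le ?_
  obtain ⟨γ₀, hγ₀, B, hB, hsub⟩ := hH₀
  have hfreq : ∃ᶠ ε in 𝓝[>] (0 : ℝ), ∃ x ∈ closure B, x ∈ P.optimal ε ∧ a' ≤ P.value ε := by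
    refine ((frequently_lt_of_lt_limsup (by isBoundedDefault) ha').and_eventually
      (hbdd.and (Ioc_mem_nhdsGT hγ₀))).mono ?_
    rintro ε ⟨hlt, hv, hε⟩
    have hne : (P.feasible ε).Nonempty := by
      rw [Set.nonempty_iff_ne_empty]
      -- Infeasibility would make the value `⊥`, which cannot exceed `a'`.
      intro h
      simp [value, h] at hlt
    obtain ⟨x, hx⟩ := P.optimal_nonempty hne hv
    exact ⟨x, subset_closure (hsub ε hε hx), hx, hlt.le⟩
  choose! y hyB hyopt hya using fun ε (h : ∃ x ∈ closure B, x ∈ P.optimal ε ∧ a' ≤ P.value ε) => h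
  set G : Set ℝ := {ε | ∃ x ∈ closure B, x ∈ P.optimal ε ∧ a' ≤ P.value ε}
  have hne : (𝓝[>] (0 : ℝ) ⊓ 𝓟 G).NeBot := frequently_mem_iff_neBot.1 hfreq
  have hG : ∀ᶠ ε in 𝓝[>] (0 : ℝ) ⊓ 𝓟 G, ε ∈ G := mem_inf_of_right (mem_principal_self _)
  obtain ⟨z, -, hz⟩ := hB.isCompact_closure.exists_mapClusterPt
    (f := 𝓝[>] (0 : ℝ) ⊓ 𝓟 G) (u := y) (le_principal_iff.2 (hG.mono fun ε hε => hyB ε hε))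
  -- An ultrafilter plays the role of a convergent subsequence of optimal solutions.
  obtain ⟨U, hU, hyU⟩ := mapClusterPt_iff_ultrafilter.1 hz
  have hUG := hG.filter_mono hU
  have he : Tendsto id (U : Filter ℝ) (𝓝[>] 0) := hU.trans inf_le_left
  have hzθ : z ∈ P.theta₁ :=
    P.mem_theta₁_of_tendsto he hyU (hUG.mono fun ε hε => (hyopt ε hε).1)
  have hobj := (continuous_coe_real_ereal.tendsto _).comp
    (P.tendsto_objective (he.mono_right nhdsWithin_le_nhds) hyU)
  refine (ge_of_tendsto hobj (hUG.mono fun ε hε => ?_)).trans (le_iSup₂_of_le z hzθ le_rfl)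
  simpa [P.value_eq_of_mem_optimal (hyopt ε hε)] using hya ε hε

/-! ### Consequences of the extended Slater condition -/

theorem exists_right_inverse_A₀ (h : P.H₁) : ∃ R : Matrix (Fin n) (Fin m) ℝ, P.A₀ * R = 1 := by
  have hs : Function.Surjective P.A₀.mulVec := by
    rw [← Matrix.coe_mulVecLin, ← LinearMap.range_eq_top]
    apply Submodule.eq_top_of_finrank_eq
    rw [Module.finrank_fin_fun]
    exact h
  exact Matrix.mulVec_surjective_iff_exists_right_inverse.1 hs

/-- If `A₀` has rank `m`, a strictly admissible pair extends to feasible points of the perturbed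
programs. -/
theorem exists_feasible_tendsto (h : P.H₁) {x0 x1 : Fin n → ℝ} (hx : (x0, x1) ∈ P.bigTheta₁)
    (hx1 : ∀ j, j ∉ P.J₀ → 0 < x1 j) (hx0 : ∀ j, j ∈ P.J₀ → 0 < x0 j) :
    ∃ y : ℝ → Fin n → ℝ, Tendsto y (𝓝[>] 0) (𝓝 x0) ∧ ∀ᶠ ε in 𝓝[>] 0, y ε ∈ P.feasible ε := by
  obtain ⟨R, hR⟩ := P.exists_right_inverse_A₀ h
  obtain ⟨⟨hfeq, hfnn⟩, heq, -⟩ := hx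
  simp only [zero_smul, add_zero] at hfeq heq hfnn
  let M : ℝ → Matrix (Fin m) (Fin m) ℝ := fun ε => (P.A₀ + ε • P.A₁) * R
  have hMc : Continuous M := by fun_prop
  have hM0 : (M 0).det = 1 := by simp [M, hR]
  -- `x0 + ε • x1` misses the constraint by `ε² A₁ x1`; `z ε` solves `(A₀ + ε A₁) z = A₁ x1`. The
  -- adjugate formula for the inverse makes continuity at `0` visible.
  let z : ℝ → Fin n → ℝ := fun ε =>
    R.mulVec (((M ε).det⁻¹ • (M ε).adjugate).mulVec (P.A₁.mulVec x1))
  have hz : ContinuousAt z 0 := by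
    have h1 : ContinuousAt (fun ε => (M ε).det⁻¹ • (M ε).adjugate) 0 :=
      (hMc.matrix_det.continuousAt.inv₀ (by simp [hM0])).smul hMc.matrix_adjugate.continuousAt
    have h2 : Continuous fun N : Matrix (Fin m) (Fin m) ℝ =>
        R.mulVec (N.mulVec (P.A₁.mulVec x1)) :=
      Continuous.matrix_mulVec continuous_const
        (Continuous.matrix_mulVec continuous_id continuous_const)
    exact h2.continuousAt.comp h1
  have hdet : ∀ᶠ ε in 𝓝 (0 : ℝ), (M ε).det ≠ 0 :=
    hMc.matrix_det.continuousAt.eventually_ne (by simp [hM0])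
  let y : ℝ → Fin n → ℝ := fun ε => x0 + ε • (x1 - ε • z ε)
  have hu : ContinuousAt (fun ε => x1 - ε • z ε) 0 :=
    continuousAt_const.sub (continuousAt_id.smul hz)
  have hy : ContinuousAt y 0 := continuousAt_const.add (continuousAt_id.smul hu)
  have hy0 : y 0 = x0 := by simp [y]
  have hcoord : ∀ j, ∀ᶠ ε in 𝓝[>] (0 : ℝ), 0 ≤ y ε j := by
    intro j
    by_cases hj : j ∈ P.J₀
    · have : ContinuousAt (fun ε => y ε j) 0 := (continuous_apply j).continuousAt.comp hy
      have := this.eventually (lt_mem_nhds (show 0 < y 0 j by rw [hy0]; exact hx0 j hj))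
      exact (this.filter_mono nhdsWithin_le_nhds).mono fun ε hε => hε.le
    · have : ContinuousAt (fun ε => (x1 - ε • z ε) j) 0 :=
        (continuous_apply j).continuousAt.comp hu
      have := this.eventually (lt_mem_nhds (show 0 < (x1 - (0 : ℝ) • z 0) j by
        simpa using hx1 j hj))
      filter_upwards [this.filter_mono nhdsWithin_le_nhds, self_mem_nhdsWithin] with ε h1 h2
      -- Off `J₀` the sign comes from the first-order term, since `x0 j` is only known to be
      -- nonnegative.
      exact add_nonneg (hfnn j) (mul_nonneg (le_of_lt h2) h1.le)
  refine ⟨y, ?_, ?_⟩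
  · have := hy.tendsto
    rw [hy0] at this
    exact this.mono_left nhdsWithin_le_nhds
  · filter_upwards [eventually_all.2 hcoord, hdet.filter_mono nhdsWithin_le_nhds] with ε h1 h2
    refine ⟨?_, h1⟩
    have hMz : (P.A₀ + ε • P.A₁).mulVec (z ε) = P.A₁.mulVec x1 := by
      simp only [z]
      rw [Matrix.mulVec_mulVec, Matrix.mulVec_mulVec]
      change (M ε * ((M ε).det⁻¹ • (M ε).adjugate)).mulVec _ = _
      rw [Matrix.mul_smul, Matrix.mul_adjugate, smul_smul, inv_mul_cancel₀ h2, one_smul,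
        Matrix.one_mulVec]
    simp only [y]
    rw [Matrix.mulVec_add, Matrix.mulVec_smul, Matrix.mulVec_sub, Matrix.mulVec_smul, hMz,
      Matrix.add_mulVec, Matrix.add_mulVec, Matrix.smul_mulVec, Matrix.smul_mulVec, hfeq,
      add_sub_cancel_right, ← heq, smul_add, add_assoc, add_comm (ε • P.A₁.mulVec x0)]

/-- `Θ₁` is convex, so a short move towards the Slater pair stays in it, gains strict positivity and
keeps the first component in the given neighbourhood. -/
theorem theta₁_subset_innerLimit_feasible (h : P.H₁) (hES : P.ES1) :
    P.theta₁ ⊆ innerLimit P.feasible := by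
  rintro x ⟨x1, ⟨hfeq, hfnn⟩, heq, hnn⟩ U hU
  obtain ⟨s0, s1, ⟨⟨hsfeq, hsfnn⟩, hseq, hsnn⟩, hs1, hs0⟩ := hES
  simp only [zero_smul, add_zero] at hfeq hfnn heq hnn hsfeq hsfnn hseq hsnn
  have hpath : ContinuousAt (fun t : ℝ => (1 - t) • x + t • s0) 0 := by fun_prop
  have hint : interior U ∈ 𝓝 ((1 - (0 : ℝ)) • x + (0 : ℝ) • s0) := by
    simpa using interior_mem_nhds.2 hU
  obtain ⟨t, htU, ht0, ht1⟩ := (((hpath.eventually hint).filter_mono nhdsWithin_le_nhds).and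
    (Ioo_mem_nhdsGT (zero_lt_one' ℝ))).exists
  have ht1' : 0 < 1 - t := sub_pos.2 ht1
  obtain ⟨y, hy, hyf⟩ := P.exists_feasible_tendsto h
    (x0 := (1 - t) • x + t • s0) (x1 := (1 - t) • x1 + t • s1) (by
      refine ⟨⟨?_, fun j => ?_⟩, ?_, fun j hj => ?_⟩
      · simp only [zero_smul, add_zero, Matrix.mulVec_add, Matrix.mulVec_smul, hfeq, hsfeq,
          ← add_smul, sub_add_cancel, one_smul]
      · exact add_nonneg (mul_nonneg ht1'.le (hfnn j)) (mul_nonneg ht0.le (hsfnn j))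
      · simp only [Matrix.mulVec_add, Matrix.mulVec_smul]
        rw [add_add_add_comm, ← smul_add, ← smul_add, heq, hseq, ← add_smul, sub_add_cancel,
          one_smul]
      · exact add_nonneg (mul_nonneg ht1'.le (hnn j hj)) (mul_nonneg ht0.le (hsnn j hj)))
    (fun j hj => add_pos_of_nonneg_of_pos (mul_nonneg ht1'.le (hnn j hj)) (mul_pos ht0 (hs1 j hj)))
    (fun j hj => add_pos_of_nonneg_of_pos (mul_nonneg ht1'.le (hfnn j)) (mul_pos ht0 (hs0 j hj)))
  filter_upwards [hyf, hy.eventually (mem_interior_iff_mem_nhds.1 htU)] with ε h1 h2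
  exact ⟨y ε, h1, h2⟩

/-- A bound on the objective near a point of the inner limit of the feasible sets. -/
theorem eventually_exists_lt_objective {x : Fin n → ℝ} (hx : x ∈ innerLimit P.feasible) {r : ℝ}
    (hr : r < P.c₀ ⬝ᵥ x) : ∀ᶠ ε in 𝓝[>] 0, ∃ y ∈ P.feasible ε, r < P.objective ε y := by
  have h := (P.tendsto_objective (tendsto_fst (f := 𝓝 (0 : ℝ)) (g := 𝓝 x)) tendsto_snd).eventually
    (lt_mem_nhds hr)
  obtain ⟨V, hV, U, hU, hVU⟩ := mem_prod_iff.1 h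
  filter_upwards [hx U hU, nhdsWithin_le_nhds hV] with ε ⟨y, hy, hyU⟩ hε
  exact ⟨y, hy, hVU (Set.mk_mem_prod hε hyU)⟩

theorem value₁_le_liminf_value (h : P.H₁) (hES : P.ES1) :
    P.value₁ ≤ liminf P.value (𝓝[>] (0 : ℝ)) := by
  refine iSup₂_le fun x hx => EReal.ge_of_forall_gt_iff_ge.1 fun r hr => ?_
  refine le_liminf_of_le (by isBoundedDefault) ?_
  filter_upwards [P.eventually_exists_lt_objective
    (P.theta₁_subset_innerLimit_feasible h hES hx) (EReal.coe_lt_coe_iff.1 hr)] with ε ⟨y, hy, hlt⟩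
  exact (EReal.coe_le_coe_iff.2 hlt.le).trans (le_iSup₂_of_le y hy le_rfl)

theorem outerLimit_optimal_subset_optimal₁ (h : P.H₁) (hES : P.ES1) :
    outerLimit P.optimal ⊆ P.optimal₁ := by
  intro x hx
  refine ⟨P.outerLimit_optimal_subset_theta₁ hx, fun y hy => le_of_forall_lt fun r hr => ?_⟩
  obtain ⟨r', hrr', hr'⟩ := exists_between hr
  refine hrr'.trans_le ?_
  obtain ⟨l, hl, h1, h2, h3⟩ := exists_tendsto_of_mem_outerLimit hx
  have hev := h1.eventually (P.eventually_exists_lt_objective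
    (P.theta₁_subset_innerLimit_feasible h hES hy) hr')
  refine ge_of_tendsto (P.tendsto_objective (h1.mono_right nhdsWithin_le_nhds) h2) ?_
  filter_upwards [hev, h3] with p ⟨w, hw, hlt⟩ hp
  exact hlt.le.trans (hp.2 w hw)

theorem tendsto_value (hbdd : ∀ᶠ ε in 𝓝[>] (0 : ℝ), P.value ε < ⊤) (hH₀ : P.H₀star)
    (h : P.H₁) (hES : P.ES1) : Tendsto P.value (𝓝[>] (0 : ℝ)) (𝓝 P.value₁) :=
  tendsto_of_le_liminf_of_limsup_le (P.value₁_le_liminf_value h hES)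
    (P.limsup_value_le_value₁ hbdd hH₀)

end PerturbedLP

theorem mainTheorem1 {m n : ℕ} (P : PerturbedLP m n)
    (hbdd : ∀ᶠ ε in 𝓝[>] (0 : ℝ), P.value ε < ⊤)
    (hH₀ : P.H₀star) (hH₂ : P.H₂) :
    outerLimit P.optimal ⊆ P.theta₁ ∧
    limsup P.value (𝓝[>] (0 : ℝ)) ≤ P.value₁ ∧
    (P.H₁ → P.ES1 →
      outerLimit P.optimal ⊆ P.optimal₁ ∧
      Tendsto P.value (𝓝[>] (0 : ℝ)) (𝓝 P.value₁) ∧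
      ∀ x ∈ P.optimal₁, P.FeasibleLimitingOptimal x) := by
  refine ⟨P.outerLimit_optimal_subset_theta₁, P.limsup_value_le_value₁ hbdd hH₀, fun h hES => ?_⟩
  have hlim := P.tendsto_value hbdd hH₀ h hES
  refine ⟨P.outerLimit_optimal_subset_optimal₁ h hES, hlim, fun x hx => ?_⟩
  exact ⟨P.theta₁_subset_innerLimit_feasible h hES hx.1, P.value₁_eq_of_mem_optimal₁ hx ▸ hlim⟩
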